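/- Fix a recursive pairing bijection $\langle\cdot,\cdot\rangle:\mathbb N^2\to\mathbb N$. Let $\mathcal G$ be the group of recursive permutations of $\mathbb N$ (product $fg$ = composition, $fg(x)=f(g(x))$). For a permutation $f$ of $\mathbb N$ let $[x]_f=\{f^k(x):k\in\mathbb Z\}$ be the cycle of $x$, and put $\mathrm{CF}(f)=\{x : |[x]_f|<\infty\}$. Let $\mathrm{Perm}$ be the set of $f\in\mathcal G$ whose cycles are the classes of a decidable equivalence relation on $\mathbb N$, let $\mathrm{Perm_{cf}}$ be the set of $f\in\mathrm{Perm}$ for which $\mathrm{CF}(f)$ is decidable, and let $F$ be the group of finitary permutations of $\mathbb N$ (those of finite support). A cycle decider of $f$ is a program which, for every $x,y$, decides on input $\langle x,y\rangle$ whether $y\in[x]_f$; a finiteness decider of $f$ is a program which decides $\mathrm{CF}(f)$. Let $\eta$ be the enumeration of $F$ that sends $\langle n,\langle t_1,\dots,t_n\rangle\rangle$ to the product $\tau(t_1)\cdots\tau(t_n)$, where $\tau(\langle x,y\rangle)$ is the transposition $(x\ y)$ (the identity if $x=y$), the empty product ($n=0$) is the identity, and tuples are coded by iterated pairing, $\langle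 t_1,\dots,t_n\rangle=\langle\langle t_1,\dots,t_{n-1}\rangle,t_n\rangle$ with $\langle t_1\rangle=t_1$. 1. If $f\in\mathrm{Perm}$ and $a,b\in F$, then $afb\in\mathrm{Perm}$. 2. If $f\in\mathrm{Perm_{cf}}$ and $a,b\in F$, then $afb\in\mathrm{Perm_{cf}}$. 3. There is a single algorithm which, given a program for any $f\in\mathrm{Perm_{cf}}$, a cycle decider and a finiteness decider of $f$, and any $z,w\in\mathbb N$, computes a cycle decider and a finiteness decider of $\eta(z)\,f\,\eta(w)$. 4. There is a $g\in\mathrm{Perm}$ for which there is no recursive function $\rho$ such that, for all $x,y$, $\rho\langle x,y\rangle$ is a cycle decider of $(x\ y)g$. 5. For every $g\in\mathrm{Perm}$, there is no recursive function $\rho$ as in part 4 if and only if $\mathrm{CF}(g)$ is undecidable. -/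

import Mathlib

namespace RecursivePermutations

open Nat.Partrec (Code)

/-- The orbit (cycle) of `x` under the permutation `f`: all `f ^ k x` with `k` an integer. -/
def cycle (f : Equiv.Perm ℕ) (x : ℕ) : Set ℕ := {y | ∃ k : ℤ, (f ^ k) x = y}

/-- The recursive permutations of the natural numbers. -/
def G : Set (Equiv.Perm ℕ) := {f | Computable (f : ℕ → ℕ)}

/-- An equivalence relation on the natural numbers is decidable. -/
def DecidableEquivalence (P : Setoid ℕ) : Prop :=
  ComputablePred fun p : ℕ × ℕ => P.r p.1 p.2

/-- The recursive permutations whose cycles are exactly the classes of `P`. -/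
def PermOf (P : Setoid ℕ) : Set (Equiv.Perm ℕ) :=
  {f | f ∈ G ∧ ∀ x : ℕ, {y | P.r x y} = cycle f x}

/-- The recursive permutations whose cycles are the classes of some decidable equivalence. -/
def Perm : Set (Equiv.Perm ℕ) :=
  ⋃ P ∈ {P : Setoid ℕ | DecidableEquivalence P}, PermOf P

/-- The cycle finiteness problem of `f`. -/
def CF (f : Equiv.Perm ℕ) : Set ℕ := {x | (cycle f x).Finite}

/-- The members of `Perm` with decidable cycle finiteness problem. -/
def PermCF : Set (Equiv.Perm ℕ) :=
  {f | f ∈ Perm ∧ ComputablePred fun x : ℕ => x ∈ CF f}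

/-- The finitary permutations: those with finite support. -/
def F : Set (Equiv.Perm ℕ) := {a | {x | a x ≠ x}.Finite}

open Classical in
/-- The truth value of a proposition as a number, `1` for true and `0` for false. -/
noncomputable def truthValue (p : Prop) : ℕ := if p then 1 else 0

/-- The program `c` computes the permutation `f`. -/
def Computes (c : Code) (f : Equiv.Perm ℕ) : Prop :=
  ∀ x : ℕ, c.eval x = Part.some (f x)

/-- The program `c` halts on every pair `⟨x, y⟩` and decides whether `x` and `y` lie in the
same cycle of `f`. -/
def DecidesCycles (c : Code) (f : Equiv.Perm ℕ) : Prop :=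
  ∀ x y : ℕ, c.eval (Nat.pair x y) = Part.some (truthValue (y ∈ cycle f x))

/-- The program `c` halts on every number `x` and decides whether the cycle of `x` under `f` is
finite. -/
def DecidesCF (c : Code) (f : Equiv.Perm ℕ) : Prop :=
  ∀ x : ℕ, c.eval x = Part.some (truthValue (x ∈ CF f))

/-- The enumeration `⟨x, y⟩ ↦ (x y)` of the transpositions, the identity included. -/
def transposition (t : ℕ) : Equiv.Perm ℕ := Equiv.swap t.unpair.1 t.unpair.2

/-- The product of the transpositions with numbers `x₁, …, xₙ` (in this order), where
`t = ⟨x₁, …, xₙ⟩ = ⟨⟨x₁, …, xₙ₋₁⟩, xₙ⟩`. -/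
def tupleProd : ℕ → ℕ → Equiv.Perm ℕ
  | 0, _ => 1
  | 1, t => transposition t
  | n + 2, t => tupleProd (n + 1) t.unpair.1 * transposition t.unpair.2

/-- The enumeration of the finitary permutations: `⟨n, ⟨x₁, …, xₙ⟩⟩` is sent to the product of
the transpositions with numbers `x₁, …, xₙ`. -/
def eta (z : ℕ) : Equiv.Perm ℕ := tupleProd z.unpair.1 z.unpair.2

/-- The enumeration `eta` runs through exactly the finitary permutations. -/
theorem mem_F_iff_exists_eta (a : Equiv.Perm ℕ) : a ∈ F ↔ ∃ z, eta z = a := by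
  have hF : a ∈ F ↔ a ∈ Subgroup.closure {σ : Equiv.Perm ℕ | σ.IsSwap} := by
    rw [mem_closure_isSwap']
    rfl
  have hsw : ∀ t, transposition t ∈ Subgroup.closure {σ : Equiv.Perm ℕ | σ.IsSwap} := by
    intro t
    rw [mem_closure_isSwap']
    refine (Set.toFinite ({t.unpair.1, t.unpair.2} : Set ℕ)).subset ?_
    intro x hx
    by_contra hne
    simp only [Set.mem_insert_iff, Set.mem_singleton_iff, not_or] at hne
    exact hx (Equiv.swap_apply_of_ne_of_ne hne.1 hne.2)
  have hprod : ∀ n t, tupleProd n t ∈ Subgroup.closure {σ : Equiv.Perm ℕ | σ.IsSwap} := by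
    intro n
    induction n with
    | zero => intro t; exact one_mem _
    | succ n ih =>
      intro t
      cases n with
      | zero => exact hsw t
      | succ n => exact mul_mem (ih _) (hsw _)
  constructor
  · intro ha
    rw [hF] at ha
    clear hF
    suffices h : ∃ n t, tupleProd (n + 1) t = a by
      obtain ⟨n, t, h⟩ := h
      exact ⟨Nat.pair (n + 1) t, by simp [eta, h]⟩
    induction ha using Subgroup.closure_induction_right with
    | one => exact ⟨0, Nat.pair 0 0, by simp [tupleProd, transposition, Equiv.Perm.one_def]⟩
    | mul_right x hx y hy ih =>
      obtain ⟨n, t, h⟩ := ih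
      obtain ⟨u, v, -, rfl⟩ := hy
      exact ⟨n + 1, Nat.pair t (Nat.pair u v), by simp [tupleProd, transposition, h]⟩
    | mul_inv_cancel x hx y hy ih =>
      obtain ⟨n, t, h⟩ := ih
      obtain ⟨u, v, -, rfl⟩ := hy
      exact ⟨n + 1, Nat.pair t (Nat.pair u v), by simp [tupleProd, transposition, h]⟩
  · rintro ⟨z, rfl⟩
    rw [hF]
    exact hprod _ _

end RecursivePermutations

/-!
Multiply a permutation `g` by a transposition and put `h = (x y) * g`. Outside of the union `X` of
the cycles of `x` and `y` nothing changes, and every point of `X` shares its `h`-cycle with `x` or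
with `y`. A search finds out which one is right for a given `u` in `X`: it iterates `h` on `u`, `x`
and `y` until `u` reaches `x` or `y` or is reached from them. So the cycle relation of `h` is known
once it is known whether `x` and `y` share an `h`-cycle,
which is one bit. This bit is determined by `g` (`sameCycle_swap_mul_iff`): if `x` and `y` are
distinct and share a `g`-cycle, then `h` splits it; if they do not share one, then `h` joins the two
cycles if and only if at least one of them is finite, because two infinite cycles only exchange
their halves. Without knowledge about finiteness the bit exists nevertheless, which gives closure of
`Perm`; with a finiteness decider it can be computed. The finiteness of the `h`-cycles of `x` and
`y` is equally determined (`mem_CF_swap_mul_and_iff`, `not_mem_CF_swap_mul`), except that when an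
infinite `g`-cycle is split, a search must find out which of the two parts is finite.

All algorithms are expressed through `Uniform`, uniform computability from programs as parameters,
whose closure properties make the new deciders computable functions of the old ones
(`exists_computable_step`). Products `η z * f * η w` follow by iteration over the transpositions
(`etaFold_spec`), because `η z * f * η w` is conjugate to `η w * η z * f` by `η w`.

Conversely, if cycle deciders of `(x y) * g` can be computed from `x` and `y`, fix an infinite cycle
of `g` and a point `y` on it (if there is none, finiteness is trivial). A point `x` off this cycle
has a finite cycle if and only if `(x y) * g` joins it with `y`
(`exists_deciders_swap_mul_iff`). Hence uniform cycle deciders exist exactly when `CF g` is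
decidable, and it remains to find a `g` in `Perm` with `CF g` undecidable: in the column of a
program `e`, let the numbers `i` form a path whose edge from `i` to `i + 1` is present as long as
`e` has not halted within `i` steps. The product of the two involutions that flip the edges of
either parity has the connected components of the path as its cycles (`sameCycle_pathPerm_iff`).
These are decidable, but the component of `0` is finite if and only if `e` halts.
-/

namespace RecursivePermutations

open Nat.Partrec (Code)
open Encodable (encode)
open Equiv Equiv.Perm

/-! ### Uniform computability -/

/-- The family `F i : α → β`, indexed by an arbitrary type `ι`, is computable uniformly in the
parameter `par i`: a computable function turns the parameter `par i` into a program for `F i`.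
The programs only need to behave well on codes of elements of `α`. -/
def Uniform {ι σ α β : Type*} [Primcodable σ] [Primcodable α] [Primcodable β]
    (par : ι → σ) (F : ι → α → β) : Prop :=
  ∃ c : σ → Code, Computable c ∧ ∀ i a, (c (par i)).eval (encode a) = Part.some (encode (F i a))

section Uniform

variable {ι σ α β γ δ : Type*} [Primcodable σ] [Primcodable α] [Primcodable β] [Primcodable γ]
  [Primcodable δ] {par : ι → σ}

theorem exists_code_of_computable {f : α → β} (hf : Computable f) :
    ∃ c : Code, ∀ a, c.eval (encode a) = Part.some (encode (f a)) := by
  obtain ⟨c, hc⟩ := Code.exists_code.1 hf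
  exact ⟨c, fun a => by simp [hc]⟩

theorem eval_comp_of_eval {c d : Code} {n m : ℕ} (h : d.eval n = Part.some m) :
    (c.comp d).eval n = c.eval m := by
  change (d.eval n).bind c.eval = _
  rw [h]
  exact Part.bind_some _ _

theorem Uniform.congr {F H : ι → α → β} (hF : Uniform par F) (h : ∀ i a, F i a = H i a) :
    Uniform par H := by
  obtain rfl : F = H := funext fun i => funext (h i)
  exact hF

theorem Uniform.of_computable {f : α → β} (hf : Computable f) : Uniform par fun _ => f := by
  obtain ⟨c, hc⟩ := exists_code_of_computable hf
  exact ⟨fun _ => c, Computable.const c, fun _ => hc⟩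

theorem Uniform.param {k : σ → β} (hk : Computable k) :
    Uniform par fun i (_ : α) => k (par i) :=
  ⟨fun s => Code.const (encode (k s)),
    Code.primrec_const.to_comp.comp (Computable.encode.comp hk), fun i a => by simp⟩

theorem Uniform.comp {F : ι → β → γ} {H : ι → α → β} (hF : Uniform par F) (hH : Uniform par H) :
    Uniform par fun i a => F i (H i a) := by
  obtain ⟨c, hc, hcF⟩ := hF
  obtain ⟨d, hd, hdH⟩ := hH
  exact ⟨fun s => (c s).comp (d s), Code.primrec₂_comp.to_comp.comp hc hd,
    fun i a => by rw [eval_comp_of_eval (hdH i a), hcF]⟩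

theorem Uniform.pair {F : ι → α → β} {H : ι → α → γ} (hF : Uniform par F) (hH : Uniform par H) :
    Uniform par fun i a => (F i a, H i a) := by
  obtain ⟨c, hc, hcF⟩ := hF
  obtain ⟨d, hd, hdH⟩ := hH
  exact ⟨fun s => (c s).pair (d s), Code.primrec₂_pair.to_comp.comp hc hd,
    fun i a => by simp [Code.eval, hdH, hcF, Seq.seq]⟩

theorem Uniform.comp₂ {k : β → γ → δ} {F : ι → α → β} {H : ι → α → γ} (hk : Computable₂ k)
    (hF : Uniform par F) (hH : Uniform par H) : Uniform par fun i a => k (F i a) (H i a) :=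
  (Uniform.of_computable (f := fun p : β × γ => k p.1 p.2) hk).comp (hF.pair hH)

theorem Uniform.fst : Uniform par fun _ (p : α × β) => p.1 := .of_computable .fst

theorem Uniform.snd : Uniform par fun _ (p : α × β) => p.2 := .of_computable .snd

theorem Uniform.id : Uniform par fun _ (a : α) => a := .of_computable .id

theorem Uniform.and {F H : ι → α → Bool} (hF : Uniform par F) (hH : Uniform par H) :
    Uniform par fun i a => F i a && H i a := .comp₂ Primrec.and.to_comp hF hH

theorem Uniform.or {F H : ι → α → Bool} (hF : Uniform par F) (hH : Uniform par H) :
    Uniform par fun i a => F i a || H i a := .comp₂ Primrec.or.to_comp hF hH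

theorem Uniform.not {F : ι → α → Bool} (hF : Uniform par F) :
    Uniform par fun i a => !F i a := (Uniform.of_computable Primrec.not.to_comp).comp hF

theorem Uniform.beq [DecidableEq β] {F H : ι → α → β} (hF : Uniform par F)
    (hH : Uniform par H) : Uniform par fun i a => F i a == H i a :=
  .comp₂ Primrec.beq.to_comp hF hH

theorem Uniform.cond {B : ι → α → Bool} {F H : ι → α → β} (hB : Uniform par B)
    (hF : Uniform par F) (hH : Uniform par H) :
    Uniform par fun i a => bif B i a then F i a else H i a :=
  (Uniform.of_computable (f := fun p : Bool × β × β => bif p.1 then p.2.1 else p.2.2)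
    (Computable.cond .fst (Computable.fst.comp .snd) (Computable.snd.comp .snd))).comp
    (hB.pair (hF.pair hH))

theorem Uniform.iterate {F : ι → α → α} (hF : Uniform par F) :
    Uniform par fun i (p : α × ℕ) => (F i)^[p.2] p.1 := by
  obtain ⟨c, hc, hcF⟩ := hF
  refine ⟨fun s => Code.prec Code.id ((c s).comp (Code.right.comp Code.right)),
    Code.primrec₂_prec.to_comp.comp (.const _)
      (Code.primrec₂_comp.to_comp.comp hc (.const _)), ?_⟩
  rintro i ⟨a, n⟩
  simp only [Encodable.encode_prod_val, Encodable.encode_nat]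
  induction n with
  | zero => simp
  | succ n ih =>
    have hr : (Code.right.comp Code.right).eval
        (Nat.pair (encode a) (Nat.pair n (encode ((F i)^[n] a)))) =
        Part.some (encode ((F i)^[n] a)) := by
      rw [eval_comp_of_eval (m := Nat.pair n (encode ((F i)^[n] a))) (by simp [Code.eval])]
      simp [Code.eval]
    rw [Code.eval_prec_succ, ih, Function.iterate_succ_apply', ← hcF, ← eval_comp_of_eval hr]
    exact Part.bind_some _ _

/-- Unbounded search is uniform as long as it always succeeds. -/
theorem Uniform.find {F : ι → α × ℕ → Bool} (hF : Uniform par F)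
    (h : ∀ i a, ∃ n, F i (a, n) = true) : Uniform par fun i a => Nat.find (h i a) := by
  obtain ⟨c, hc, hcF⟩ := hF.not
  refine ⟨fun s => (Code.rfind' (c s)).comp (Code.pair Code.id Code.zero),
    Code.primrec₂_comp.to_comp.comp (Code.primrec_rfind'.to_comp.comp hc) (.const _), ?_⟩
  intro i a
  have hcF' : ∀ n, (c (par i)).eval (Nat.pair (encode a) n) =
      Part.some (encode (!F i (a, n))) := fun n => hcF i (a, n)
  let p : ℕ →. Bool := fun n => Part.some (F i (a, n))
  have key : Nat.find (h i a) ∈ Nat.rfind p := by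
    rw [Nat.mem_rfind]
    refine ⟨by simp [p, Nat.find_spec (h i a)], fun {m} hm => ?_⟩
    have := Nat.find_min (h i a) hm
    simpa [p] using this
  have e : ∀ b : Bool, decide (encode (!b) = 0) = b := by decide
  have hp : (fun n => (fun m => decide (m = 0)) <$>
      (c (par i)).eval (Nat.pair (encode a) (n + 0))) = p := by
    funext n
    rw [add_zero, hcF', Part.map_eq_map, Part.map_some, e]
  rw [eval_comp_of_eval (m := Nat.pair (encode a) 0)
    (by simp [Code.eval, Seq.seq, pure, PFun.pure])]
  simp only [Code.eval, Nat.unpaired, Nat.unpair_pair]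
  rw [hp, Part.eq_some_iff.2 key]
  simp

end Uniform

/-! ### Programs, computable functions and decidable predicates -/

section Programs

variable {α β : Type*} [Primcodable α] [Primcodable β]

theorem computable_of_eval {f : α → β} {c : Code}
    (h : ∀ a, c.eval (encode a) = Part.some (encode (f a))) : Computable f := by
  have hp : Partrec fun a : α => c.eval (encode a) :=
    Code.eval_part.comp (Computable.const c) Computable.encode
  exact Computable.encode_iff.1 (hp.of_eq_tot fun a => by rw [h a]; exact Part.mem_some _)

theorem truthValue_eq_encode {p : Prop} {b : Bool} (h : p ↔ b = true) :
    truthValue p = encode b := by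
  cases b <;> simp [truthValue, h]

theorem computablePred_iff_exists_code {p : α → Prop} :
    ComputablePred p ↔ ∃ c : Code, ∀ a, c.eval (encode a) = Part.some (truthValue (p a)) := by
  classical
  have key : ∀ a, truthValue (p a) = encode (decide (p a)) := fun a =>
    truthValue_eq_encode (by simp)
  simp only [key]
  exact ⟨fun h => exists_code_of_computable h.decide,
    fun ⟨c, hc⟩ => ⟨fun _ => inferInstance, computable_of_eval hc⟩⟩

theorem computablePred_cycle_iff {f : Equiv.Perm ℕ} :
    (ComputablePred fun p : ℕ × ℕ => p.2 ∈ cycle f p.1) ↔ ∃ d, DecidesCycles d f := by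
  rw [computablePred_iff_exists_code]
  exact exists_congr fun d => Prod.forall

theorem computablePred_CF_iff {f : Equiv.Perm ℕ} :
    (ComputablePred fun x : ℕ => x ∈ CF f) ↔ ∃ e, DecidesCF e f :=
  computablePred_iff_exists_code

theorem mem_G_iff {f : Equiv.Perm ℕ} : f ∈ G ↔ ∃ p, Computes p f :=
  ⟨fun h => exists_code_of_computable h, fun ⟨_, hp⟩ => computable_of_eval hp⟩

theorem mem_Perm_iff {f : Equiv.Perm ℕ} :
    f ∈ Perm ↔ ∃ p d, Computes p f ∧ DecidesCycles d f := by
  rw [exists_comm]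
  simp only [exists_and_left, exists_and_right, ← mem_G_iff, ← computablePred_cycle_iff]
  simp only [Perm, Set.mem_iUnion, exists_prop]
  constructor
  · rintro ⟨P, hP, hf, h⟩
    exact ⟨hf, ComputablePred.of_eq hP fun p => Set.ext_iff.1 (h p.1) p.2⟩
  · rintro ⟨hf, h⟩
    exact ⟨Equiv.Perm.SameCycle.setoid f, h, hf, fun x => rfl⟩

theorem mem_PermCF_iff {f : Equiv.Perm ℕ} :
    f ∈ PermCF ↔ ∃ p d e, Computes p f ∧ DecidesCycles d f ∧ DecidesCF e f := by
  simp only [PermCF, Set.mem_ofPred_eq, mem_Perm_iff, computablePred_CF_iff]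
  exact ⟨fun ⟨⟨p, d, hp, hd⟩, e, he⟩ => ⟨p, d, e, hp, hd, he⟩,
    fun ⟨p, d, e, hp, hd, he⟩ => ⟨⟨p, d, hp, hd⟩, e, he⟩⟩

end Programs

/-! ### Cycles of a permutation multiplied by a transposition -/

theorem mem_CF_iff {f : Equiv.Perm ℕ} {x : ℕ} : x ∈ CF f ↔ {y | f.SameCycle x y}.Finite := Iff.rfl

theorem _root_.Equiv.Perm.SameCycle.mem_CF_iff {f : Equiv.Perm ℕ} {x y : ℕ} (h : f.SameCycle x y) :
    x ∈ CF f ↔ y ∈ CF f := by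
  rw [RecursivePermutations.mem_CF_iff, RecursivePermutations.mem_CF_iff]
  have : {z | f.SameCycle x z} = {z | f.SameCycle y z} :=
    Set.ext fun z => ⟨h.symm.trans, h.trans⟩
  rw [this]

theorem sameCycle_iff_exists_iterate {f : Equiv.Perm ℕ} {x y : ℕ} :
    f.SameCycle x y ↔ ∃ n : ℕ, f^[n] x = y ∨ f^[n] y = x := by
  constructor
  · rintro ⟨k, rfl⟩
    obtain ⟨n, rfl | rfl⟩ := Int.eq_nat_or_neg k
    · exact ⟨n, .inl (by simp [iterate_eq_pow])⟩
    · exact ⟨n, .inr (by simp [iterate_eq_pow])⟩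
  · rintro ⟨n, rfl | rfl⟩
    · exact ⟨n, by simp [iterate_eq_pow]⟩
    · exact SameCycle.symm ⟨n, by simp [iterate_eq_pow]⟩

/-- A set that is stable under a permutation and its inverse contains the cycles it meets. -/
theorem _root_.Equiv.Perm.SameCycle.mem_of_forall {f : Equiv.Perm ℕ} {S : Set ℕ}
    (hS : ∀ u, f u ∈ S ↔ u ∈ S) {x y : ℕ} (h : f.SameCycle x y) (hx : x ∈ S) : y ∈ S := by
  have hn : ∀ n u, f^[n] u ∈ S ↔ u ∈ S := by
    intro n
    induction n with
    | zero => simp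
    | succ n ih => intro u; rw [Function.iterate_succ_apply, ih, hS]
  obtain ⟨n, rfl | rfl⟩ := sameCycle_iff_exists_iterate.1 h
  · exact (hn _ _).2 hx
  · exact (hn _ _).1 hx

/-- A finite set that is mapped into itself contains the cycles it meets. -/
theorem _root_.Equiv.Perm.SameCycle.mem_of_mapsTo {f : Equiv.Perm ℕ} {S : Set ℕ}
    (hS : S.Finite) (hm : Set.MapsTo f S S) {x y : ℕ} (h : f.SameCycle x y) (hx : x ∈ S) :
    y ∈ S := by
  refine h.mem_of_forall (fun u => ⟨fun hu => ?_, fun hu => hm hu⟩) hx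
  obtain ⟨v, hv, hvu⟩ := ((hS.injOn_iff_bijOn_of_mapsTo hm).1 f.injective.injOn).surjOn hu
  rwa [← f.injective hvu]

theorem exists_iterate_of_mem_CF {f : Equiv.Perm ℕ} {x : ℕ} (h : x ∈ CF f) :
    ∃ n : ℕ, f^[n + 1] x = x := by
  have hni : ¬ Function.Injective fun n : ℕ => f^[n] x := fun hi =>
    Set.infinite_of_injective_forall_mem hi
      (fun n => sameCycle_iff_exists_iterate.2 ⟨n, .inl rfl⟩) h
  simp only [Function.Injective, not_forall] at hni
  obtain ⟨a, b, hab, hne⟩ := hni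
  wlog hlt : a < b generalizing a b
  · exact this b a hab.symm (Ne.symm hne) (by omega)
  obtain ⟨k, rfl⟩ := Nat.exists_eq_add_of_lt hlt
  refine ⟨k, (f.injective.iterate a) ?_⟩
  rw [← Function.iterate_add_apply, ← add_assoc]
  exact hab.symm

theorem mem_CF_of_iterate {f : Equiv.Perm ℕ} {x n : ℕ} (hn : f^[n + 1] x = x) : x ∈ CF f := by
  let S : Set ℕ := (fun i => f^[i] x) '' Set.Iic n
  have hfin : S.Finite := (Set.finite_Iic n).image _
  have hmaps : Set.MapsTo f S S := by
    rintro _ ⟨i, hi, rfl⟩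
    rcases Nat.lt_or_ge i n with h | h
    · exact ⟨i + 1, h, Function.iterate_succ_apply' f i x⟩
    · obtain rfl : i = n := le_antisymm hi h
      exact ⟨0, Nat.zero_le _, by rw [← Function.iterate_succ_apply' f, hn]; rfl⟩
  exact hfin.subset fun y hy => SameCycle.mem_of_mapsTo hfin hmaps hy ⟨0, Nat.zero_le _, rfl⟩

section SwapMul

variable {g : Equiv.Perm ℕ} {x y : ℕ}

theorem sameCycle_of_sameCycle_swap_mul {u v : ℕ} (hx : ¬ g.SameCycle x u)
    (hy : ¬ g.SameCycle y u) (h : (swap x y * g).SameCycle u v) : g.SameCycle u v := by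
  refine h.mem_of_forall (S := {v | g.SameCycle u v}) (fun w => ?_) (SameCycle.refl g u)
  have hne : ∀ w, g.SameCycle u w → w ≠ x ∧ w ≠ y := fun w hw =>
    ⟨fun e => hx (e ▸ hw.symm), fun e => hy (e ▸ hw.symm)⟩
  simp only [Set.mem_ofPred_eq, Equiv.Perm.mul_apply]
  constructor
  · intro hw
    have h1 := hne _ hw
    have h2 : swap x y (swap x y (g w)) = swap x y (g w) := swap_apply_of_ne_of_ne h1.1 h1.2
    rw [swap_apply_self] at h2
    rw [← h2] at hw
    exact sameCycle_apply_right.1 hw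
  · intro hw
    have h1 := hne _ (sameCycle_apply_right.2 hw)
    rw [swap_apply_of_ne_of_ne h1.1 h1.2]
    exact sameCycle_apply_right.2 hw

/-- Since `g = (x y) * ((x y) * g)`, every fact about the pair `g`, `(x y) * g` may be used with
the two permutations exchanged. -/
theorem sameCycle_swap_mul_iff_of_not {u v : ℕ} (hx : ¬ g.SameCycle x u)
    (hy : ¬ g.SameCycle y u) : (swap x y * g).SameCycle u v ↔ g.SameCycle u v := by
  refine ⟨sameCycle_of_sameCycle_swap_mul hx hy, fun h => ?_⟩
  rw [← swap_mul_self_mul x y g] at h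
  exact sameCycle_of_sameCycle_swap_mul
    (fun h' => hx (sameCycle_of_sameCycle_swap_mul hx hy h'.symm).symm)
    (fun h' => hy (sameCycle_of_sameCycle_swap_mul hx hy h'.symm).symm) h

theorem mem_CF_swap_mul_iff_of_not {u : ℕ} (hx : ¬ g.SameCycle x u)
    (hy : ¬ g.SameCycle y u) : u ∈ CF (swap x y * g) ↔ u ∈ CF g := by
  simp only [mem_CF_iff, sameCycle_swap_mul_iff_of_not hx hy]

/-- The union of the cycles of `x` and `y` is not changed by `(x y)`. -/
theorem sameCycle_swap_mul_or {u : ℕ} (h : g.SameCycle x u ∨ g.SameCycle y u) :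
    (swap x y * g).SameCycle x u ∨ (swap x y * g).SameCycle y u := by
  by_contra! hn
  have key : ∀ v, g.SameCycle u v → (swap x y * g).SameCycle u v := fun v hv => by
    rw [← swap_mul_self_mul x y g] at hv
    exact sameCycle_of_sameCycle_swap_mul hn.1 hn.2 hv
  rcases h with h | h
  · exact hn.1 (key _ h.symm).symm
  · exact hn.2 (key _ h.symm).symm

theorem not_sameCycle_swap_mul_of_iterate {n : ℕ} (hne : x ≠ y) (h : g^[n] x = y) :
    ¬ (swap x y * g).SameCycle x y ∧ x ∈ CF (swap x y * g) := by
  classical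
  have hex : ∃ n, g^[n] x = y := ⟨n, h⟩
  obtain ⟨n, h, hmin⟩ : ∃ n, g^[n] x = y ∧ ∀ m < n, g^[m] x ≠ y :=
    ⟨Nat.find hex, Nat.find_spec hex, fun m hm => Nat.find_min hex hm⟩
  have hn : 0 < n := Nat.pos_of_ne_zero fun e => hne (by simpa [e] using h)
  -- `(x y) * g` closes the segment of the cycle of `g` that leads from `x` to `y`.
  let S : Set ℕ := (fun i => g^[i] x) '' Set.Iio n
  have hfin : S.Finite := (Set.finite_Iio n).image _
  have hxS : x ∈ S := ⟨0, hn, rfl⟩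
  have hmaps : Set.MapsTo (swap x y * g) S S := by
    rintro _ ⟨i, hi, rfl⟩
    rw [Equiv.Perm.mul_apply, ← Function.iterate_succ_apply' g]
    rcases Nat.lt_or_ge (i + 1) n with hlt | hge
    · rw [swap_apply_of_ne_of_ne _ (hmin _ hlt)]
      · exact ⟨i + 1, hlt, rfl⟩
      · intro e
        refine hmin (n - (i + 1)) (by omega) ?_
        rw [← h]
        conv_lhs => rw [← e]
        rw [← Function.iterate_add_apply]
        congr 2
        omega
    · obtain rfl : i + 1 = n := le_antisymm hi hge
      rw [h, swap_apply_right]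
      exact hxS
  refine ⟨fun hc => ?_, hfin.subset fun z hz => SameCycle.mem_of_mapsTo hfin hmaps hz hxS⟩
  obtain ⟨i, hi, e⟩ := SameCycle.mem_of_mapsTo hfin hmaps hc hxS
  exact hmin i hi e

/-- Multiplication by `(x y)` splits a cycle through `x` and `y` in two, one of them finite. -/
theorem not_sameCycle_swap_mul (hne : x ≠ y) (h : g.SameCycle x y) :
    ¬ (swap x y * g).SameCycle x y ∧ (x ∈ CF (swap x y * g) ∨ y ∈ CF (swap x y * g)) := by
  obtain ⟨n, h | h⟩ := sameCycle_iff_exists_iterate.1 h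
  · exact (not_sameCycle_swap_mul_of_iterate hne h).imp_right .inl
  · have := not_sameCycle_swap_mul_of_iterate hne.symm h
    rw [swap_comm, sameCycle_comm] at this
    exact this.imp_right .inr

/-- A finite cycle through `x` is inserted into the cycle of `y`: after one round through the
former, `(x y) * g` leads from `x` to `y`. -/
theorem sameCycle_swap_mul_of_mem_CF (h : ¬ g.SameCycle x y) (hx : x ∈ CF g) :
    (swap x y * g).SameCycle x y := by
  classical
  have hex := exists_iterate_of_mem_CF hx
  obtain ⟨n, hn, hmin⟩ : ∃ n, g^[n + 1] x = x ∧ ∀ m < n, g^[m + 1] x ≠ x :=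
    ⟨Nat.find hex, Nat.find_spec hex, fun m hm => Nat.find_min hex hm⟩
  have hit : ∀ i ≤ n, (swap x y * g)^[i] x = g^[i] x := by
    intro i
    induction i with
    | zero => intro _; rfl
    | succ i ih =>
      intro hi
      rw [Function.iterate_succ_apply', ih (by omega), Equiv.Perm.mul_apply,
        ← Function.iterate_succ_apply' g]
      exact swap_apply_of_ne_of_ne (hmin i hi)
        fun e => h (sameCycle_iff_exists_iterate.2 ⟨_, .inl e⟩)
  refine sameCycle_iff_exists_iterate.2 ⟨n + 1, .inl ?_⟩
  rw [Function.iterate_succ_apply', hit n le_rfl, Equiv.Perm.mul_apply,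
    ← Function.iterate_succ_apply' g, hn, swap_apply_left]

theorem sameCycle_swap_mul_iff (hne : x ≠ y) :
    (swap x y * g).SameCycle x y ↔ ¬ g.SameCycle x y ∧ (x ∈ CF g ∨ y ∈ CF g) := by
  constructor
  · intro h
    have := not_sameCycle_swap_mul hne h
    rwa [swap_mul_self_mul] at this
  · rintro ⟨h, hx | hy⟩
    · exact sameCycle_swap_mul_of_mem_CF h hx
    · rw [swap_comm, sameCycle_comm]
      exact sameCycle_swap_mul_of_mem_CF (fun h' => h h'.symm) hy

theorem mem_CF_swap_mul_and (h : x ∈ CF g ∧ y ∈ CF g) :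
    x ∈ CF (swap x y * g) ∧ y ∈ CF (swap x y * g) := by
  have key : ∀ v u, (v = x ∨ v = y) → (swap x y * g).SameCycle v u →
      u ∈ {u | g.SameCycle x u} ∪ {u | g.SameCycle y u} := by
    intro v u hv hu
    have := sameCycle_swap_mul_or (g := swap x y * g) (x := x) (y := y) (u := u)
      (by rcases hv with rfl | rfl <;> simp [hu])
    rwa [swap_mul_self_mul] at this
  exact ⟨(h.1.union h.2).subset fun u => key x u (.inl rfl),
    (h.1.union h.2).subset fun u => key y u (.inr rfl)⟩

theorem mem_CF_swap_mul_and_iff :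
    (x ∈ CF (swap x y * g) ∧ y ∈ CF (swap x y * g)) ↔ x ∈ CF g ∧ y ∈ CF g := by
  refine ⟨fun h => ?_, mem_CF_swap_mul_and⟩
  have := mem_CF_swap_mul_and h
  rwa [swap_mul_self_mul] at this

/-- When `x` and `y` lie in different cycles, not both finite, the new cycles are infinite: either
the two cycles are joined, or both are infinite and exchange their halves. -/
theorem not_mem_CF_swap_mul (h : ¬ g.SameCycle x y) (hn : ¬ (x ∈ CF g ∧ y ∈ CF g)) :
    x ∉ CF (swap x y * g) ∧ y ∉ CF (swap x y * g) := by
  rw [← mem_CF_swap_mul_and_iff] at hn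
  by_cases hc : (swap x y * g).SameCycle x y
  · have := hc.mem_CF_iff
    tauto
  · constructor
    · intro hx
      have := sameCycle_swap_mul_of_mem_CF hc hx
      rw [swap_mul_self_mul] at this
      exact h this
    · intro hy
      have := sameCycle_swap_mul_of_mem_CF (fun h' => hc h'.symm) hy
      rw [swap_comm, swap_mul_self_mul] at this
      exact h this.symm

end SwapMul

/-! ### Deciders for a permutation multiplied by a transposition -/

/-- A permutation `g` with a program, a cycle decider, and a program for a total function `E` that
tells at least of the points `x`, `y` of the pair `t = ⟨x, y⟩` whether their cycles are finite. -/
structure SwapData where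
  /-- the three programs -/
  codes : Code × Code × Code
  /-- the number of the transposition -/
  t : ℕ
  /-- the permutation -/
  g : Equiv.Perm ℕ
  /-- the function that knows about the finiteness of the cycles of `x` and `y` -/
  E : ℕ → Bool
  computes : Computes codes.1 g
  decidesCycles : DecidesCycles codes.2.1 g
  eval_E : ∀ u, codes.2.2.eval u = Part.some (encode (E u))
  E_left : E t.unpair.1 = true ↔ t.unpair.1 ∈ CF g
  E_right : E t.unpair.2 = true ↔ t.unpair.2 ∈ CF g

namespace SwapData

/-- The programs and the transposition, as a parameter for uniform computability. -/
def par (i : SwapData) : (Code × Code × Code) × ℕ := (i.codes, i.t)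

/-- The first point of the transposition. -/
def x (i : SwapData) : ℕ := i.t.unpair.1

/-- The second point of the transposition. -/
def y (i : SwapData) : ℕ := i.t.unpair.2

/-- The product of the transposition and the permutation. -/
def h (i : SwapData) : Equiv.Perm ℕ := transposition i.t * i.g

theorem h_eq (i : SwapData) : i.h = swap i.x i.y * i.g := rfl

open Classical in
/-- The cycle relation of `g` as a Boolean function. -/
noncomputable def D (i : SwapData) (p : ℕ × ℕ) : Bool := decide (i.g.SameCycle p.1 p.2)

theorem D_iff (i : SwapData) (u v : ℕ) : i.D (u, v) = true ↔ i.g.SameCycle u v := by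
  simp [D]

/-- The union of the cycles of `x` and `y`, as a Boolean function. -/
noncomputable def X (i : SwapData) (u : ℕ) : Bool := i.D (i.x, u) || i.D (i.y, u)

/-- Recognizes the `n` for which `n` applications of `h` connect `u` with `x` or `y`; for `u`
outside of the cycles of `x` and `y`, every `n` is accepted. -/
noncomputable def reach (i : SwapData) (p : ℕ × ℕ) : Bool :=
  !i.X p.1 || ((i.h^[p.2] p.1 == i.x || i.h^[p.2] i.x == p.1) ||
    (i.h^[p.2] p.1 == i.y || i.h^[p.2] i.y == p.1))

theorem exists_reach (i : SwapData) (u : ℕ) : ∃ n, i.reach (u, n) = true := by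
  by_cases hX : i.X u = true
  · have : i.g.SameCycle i.x u ∨ i.g.SameCycle i.y u := by simpa [X, D_iff] using hX
    have := sameCycle_swap_mul_or this
    rw [← h_eq] at this
    rcases this with h | h <;> obtain ⟨n, hn | hn⟩ := sameCycle_iff_exists_iterate.1 h <;>
      exact ⟨n, by simp [reach, hn]⟩
  · exact ⟨0, by simp [reach, hX]⟩

/-- A representative of the cycle of `u` under `h`: one of `x`, `y` if `u` lies in the union of
their cycles, and `u` itself otherwise. -/
noncomputable def rep (i : SwapData) (u : ℕ) : ℕ :=
  bif i.X u then
    bif i.h^[Nat.find (i.exists_reach u)] u == i.x || i.h^[Nat.find (i.exists_reach u)] i.x == u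
    then i.x else i.y
  else u

theorem rep_spec (i : SwapData) (u : ℕ) : i.h.SameCycle u (i.rep u) ∧
    (i.rep u = i.x ∨ i.rep u = i.y ∨
      ¬ i.g.SameCycle i.x (i.rep u) ∧ ¬ i.g.SameCycle i.y (i.rep u)) := by
  by_cases hX : i.X u = true
  · have hs := Nat.find_spec (i.exists_reach u)
    rw [rep]
    generalize Nat.find (i.exists_reach u) = n at hs ⊢
    by_cases h1 : (i.h^[n] u == i.x || i.h^[n] i.x == u) = true
    · simp only [hX, h1, cond_true, true_or, and_true]
      simp only [Bool.or_eq_true, beq_iff_eq] at h1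
      exact sameCycle_iff_exists_iterate.2 ⟨n, h1⟩
    · simp only [reach, hX, Bool.not_true, Bool.false_or, h1] at hs
      simp only [hX, h1, cond_true, cond_false, true_or, or_true, and_true]
      simp only [Bool.or_eq_true, beq_iff_eq] at hs
      exact sameCycle_iff_exists_iterate.2 ⟨n, hs⟩
  · have : i.rep u = u := by simp [rep, hX]
    rw [this]
    refine ⟨SameCycle.refl _ _, .inr (.inr ?_)⟩
    simpa [X, D_iff] using hX

/-- Decides the cycle relation of `h` on representatives. -/
noncomputable def repCycles (i : SwapData) (p : ℕ × ℕ) : Bool :=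
  p.1 == p.2 ||
    bif (p.1 == i.x && p.2 == i.y) || (p.1 == i.y && p.2 == i.x) then
      !i.D (i.x, i.y) && (i.E i.x || i.E i.y)
    else i.D p

theorem repCycles_iff (i : SwapData) {a b : ℕ}
    (ha : a = i.x ∨ a = i.y ∨ ¬ i.g.SameCycle i.x a ∧ ¬ i.g.SameCycle i.y a)
    (hb : b = i.x ∨ b = i.y ∨ ¬ i.g.SameCycle i.x b ∧ ¬ i.g.SameCycle i.y b) :
    i.repCycles (a, b) = true ↔ i.h.SameCycle a b := by
  by_cases hab : a = b
  · subst hab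
    simp [repCycles, SameCycle.refl]
  have key : i.x ≠ i.y → (i.h.SameCycle i.x i.y ↔
      (!i.D (i.x, i.y) && (i.E i.x || i.E i.y)) = true) := fun hne => by
    have h1 : i.E i.x = true ↔ i.x ∈ CF i.g := i.E_left
    have h2 : i.E i.y = true ↔ i.y ∈ CF i.g := i.E_right
    rw [h_eq, sameCycle_swap_mul_iff hne, ← h1, ← h2, ← D_iff]
    simp
  by_cases hxy : a = i.x ∧ b = i.y
  · obtain ⟨rfl, rfl⟩ := hxy
    rw [key hab]
    simp [repCycles, hab]
  by_cases hyx : a = i.y ∧ b = i.x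
  · obtain ⟨rfl, rfl⟩ := hyx
    rw [sameCycle_comm, key (Ne.symm hab)]
    simp [repCycles, hab]
  have hD : i.repCycles (a, b) = i.D (a, b) := by
    have hc : ((a == i.x && b == i.y) || (a == i.y && b == i.x)) = false := by
      simp only [Bool.or_eq_false_iff, Bool.and_eq_false_iff, beq_eq_false_iff_ne]
      tauto
    simp only [repCycles, hc, cond_false, Bool.or_eq_right_iff_imp, beq_iff_eq]
    exact fun h => absurd h hab
  rw [hD, D_iff, h_eq]
  by_cases ha' : ¬ i.g.SameCycle i.x a ∧ ¬ i.g.SameCycle i.y a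
  · exact (sameCycle_swap_mul_iff_of_not ha'.1 ha'.2).symm
  · have hb' : ¬ i.g.SameCycle i.x b ∧ ¬ i.g.SameCycle i.y b := by
      rcases ha with rfl | rfl | ha
      · rcases hb with rfl | rfl | hb <;> tauto
      · rcases hb with rfl | rfl | hb <;> tauto
      · exact absurd ha ha'
    rw [sameCycle_comm, sameCycle_comm (f := swap i.x i.y * i.g)]
    exact (sameCycle_swap_mul_iff_of_not hb'.1 hb'.2).symm

/-- Recognizes the `n` for which `n + 1` applications of `h` lead `x` or `y` back to itself.  If
`x` and `y` are not distinct points of the same infinite cycle of `g`, every `n` is accepted. -/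
noncomputable def close (i : SwapData) (p : ℕ × ℕ) : Bool :=
  ((i.x == i.y) || !i.D (i.x, i.y)) || (i.h^[p.2 + 1] i.x == i.x || i.h^[p.2 + 1] i.y == i.y)

theorem exists_close (i : SwapData) (u : ℕ) : ∃ n, i.close (u, n) = true := by
  by_cases hs : i.x ≠ i.y ∧ i.g.SameCycle i.x i.y
  · have := (not_sameCycle_swap_mul hs.1 hs.2).2
    rw [← h_eq] at this
    rcases this with h | h <;> obtain ⟨n, hn⟩ := exists_iterate_of_mem_CF h <;>
      exact ⟨n, by simp only [close, hn]; simp⟩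
  · refine ⟨0, ?_⟩
    by_cases hxy : i.x = i.y
    · simp [close, hxy]
    · have : ¬ i.D (i.x, i.y) = true := by rw [D_iff]; tauto
      simp only [close, this]
      simp

/-- Decides on representatives whether their cycles under `h` are finite. -/
noncomputable def repFinite (i : SwapData) (a : ℕ) : Bool :=
  bif i.x == i.y || !(a == i.x || a == i.y) then i.E a
  else bif i.E i.x && i.E i.y then true
  else i.D (i.x, i.y) && i.h^[Nat.find (i.exists_close a) + 1] a == a

theorem repFinite_iff (i : SwapData) (hE : ∀ u, i.E u = true ↔ u ∈ CF i.g) {a : ℕ}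
    (ha : a = i.x ∨ a = i.y ∨ ¬ i.g.SameCycle i.x a ∧ ¬ i.g.SameCycle i.y a) :
    i.repFinite a = true ↔ a ∈ CF i.h := by
  by_cases hxy : i.x = i.y
  · have : i.h = i.g := by simp [h_eq, hxy, swap_self, ← Equiv.Perm.one_def]
    simp [repFinite, hxy, hE, this]
  by_cases hax : ¬ (a = i.x ∨ a = i.y)
  · have : i.repFinite a = i.E a := by
      have : (a == i.x || a == i.y) = false := by simpa using hax
      simp [repFinite, this]
    rw [this, hE, h_eq]
    exact (mem_CF_swap_mul_iff_of_not (by tauto) (by tauto)).symm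
  rw [not_not] at hax
  have hc : (i.x == i.y || !(a == i.x || a == i.y)) = false := by
    rcases hax with rfl | rfl <;> simp [hxy]
  by_cases hb : i.x ∈ CF i.g ∧ i.y ∈ CF i.g
  · have := mem_CF_swap_mul_and hb
    rw [← h_eq] at this
    simp only [repFinite, hc, (hE _).2 hb.1, (hE _).2 hb.2, Bool.and_true, cond_false, cond_true,
      true_iff]
    rcases hax with rfl | rfl
    exacts [this.1, this.2]
  have hb' : (i.E i.x && i.E i.y) = false := by
    rw [← Bool.not_eq_true, Bool.and_eq_true, hE, hE]
    exact hb
  by_cases hs : i.g.SameCycle i.x i.y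
  · have hn := Nat.find_spec (i.exists_close a)
    rw [repFinite]
    generalize Nat.find (i.exists_close a) = n at hn ⊢
    have hD : i.D (i.x, i.y) = true := (i.D_iff _ _).2 hs
    have hxyb : (i.x == i.y) = false := by simpa using hxy
    simp only [close, hD, hxyb, Bool.not_true, Bool.or_false, Bool.false_or, Bool.or_eq_true,
      beq_iff_eq] at hn
    simp only [hc, hb', cond_false, hD, Bool.true_and, beq_iff_eq]
    refine ⟨mem_CF_of_iterate, fun h => ?_⟩
    -- Only one of the two cycles into which that of `x` and `y` splits is finite.
    have hnot : ¬ (i.x ∈ CF i.h ∧ i.y ∈ CF i.h) := by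
      rwa [h_eq, mem_CF_swap_mul_and_iff]
    rcases hax with rfl | rfl
    · exact hn.resolve_right fun e => hnot ⟨h, mem_CF_of_iterate e⟩
    · exact hn.resolve_left fun e => hnot ⟨mem_CF_of_iterate e, h⟩
  · have := not_mem_CF_swap_mul hs hb
    rw [← h_eq] at this
    have hD : i.D (i.x, i.y) = false := by rwa [← Bool.not_eq_true, D_iff]
    simp only [repFinite, hc, hb', cond_false, hD, Bool.false_and, Bool.false_eq_true, false_iff]
    rcases hax with rfl | rfl
    exacts [this.1, this.2]

section Uniform

variable {α : Type*} [Primcodable α]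

theorem uniform_x : Uniform par fun i (_ : α) => i.x :=
  .param (k := fun s : (Code × Code × Code) × ℕ => s.2.unpair.1)
    (Computable.fst.comp (Computable.unpair.comp .snd))

theorem uniform_y : Uniform par fun i (_ : α) => i.y :=
  .param (k := fun s : (Code × Code × Code) × ℕ => s.2.unpair.2)
    (Computable.snd.comp (Computable.unpair.comp .snd))

theorem uniform_g : Uniform par fun i u => i.g u :=
  ⟨fun s => s.1.1, Computable.fst.comp .fst, fun i => i.computes⟩

theorem uniform_E : Uniform par fun i u => i.E u :=
  ⟨fun s => s.1.2.2, Computable.snd.comp (Computable.snd.comp .fst), fun i => i.eval_E⟩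

theorem uniform_D : Uniform par D :=
  ⟨fun s => s.1.2.1, Computable.fst.comp (Computable.snd.comp .fst), fun i p => by
    exact (i.decidesCycles p.1 p.2).trans (congrArg _ (truthValue_eq_encode (i.D_iff _ _).symm))⟩

theorem uniform_h : Uniform par fun i u => i.h u :=
  ((uniform_g.beq uniform_x).cond uniform_y
    ((uniform_g.beq uniform_y).cond uniform_x uniform_g)).congr fun i u => by
      simp only [h_eq, Equiv.Perm.mul_apply, swap_apply_def, Bool.cond_eq_ite, beq_iff_eq]

theorem uniform_iterate {U : SwapData → α → ℕ} {N : SwapData → α → ℕ} (hU : Uniform par U)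
    (hN : Uniform par N) : Uniform par fun i a => i.h^[N i a] (U i a) :=
  uniform_h.iterate.comp (hU.pair hN)

theorem uniform_X : Uniform par X :=
  (uniform_D.comp (uniform_x.pair .id)).or (uniform_D.comp (uniform_y.pair .id))

theorem uniform_reach : Uniform par reach :=
  (uniform_X.comp .fst).not.or <|
    (((uniform_iterate .fst .snd).beq uniform_x).or ((uniform_iterate uniform_x .snd).beq .fst)).or
    (((uniform_iterate .fst .snd).beq uniform_y).or ((uniform_iterate uniform_y .snd).beq .fst))

theorem uniform_rep : Uniform par rep :=
  have hf := uniform_reach.find exists_reach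
  uniform_X.cond ((((uniform_iterate .id hf).beq uniform_x).or
    ((uniform_iterate uniform_x hf).beq .id)).cond uniform_x uniform_y) .id

theorem uniform_repCycles : Uniform par repCycles :=
  (Uniform.fst.beq .snd).or <|
    (((Uniform.fst.beq uniform_x).and (Uniform.snd.beq uniform_y)).or
      ((Uniform.fst.beq uniform_y).and (Uniform.snd.beq uniform_x))).cond
    ((uniform_D.comp (uniform_x.pair uniform_y)).not.and
      ((uniform_E.comp uniform_x).or (uniform_E.comp uniform_y))) uniform_D

theorem uniform_close : Uniform par close :=
  have hs : Uniform par fun _ (p : ℕ × ℕ) => p.2 + 1 :=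
    .of_computable (Computable.succ.comp .snd)
  ((uniform_x.beq uniform_y).or (uniform_D.comp (uniform_x.pair uniform_y)).not).or
    (((uniform_iterate uniform_x hs).beq uniform_x).or
      ((uniform_iterate uniform_y hs).beq uniform_y))

theorem uniform_repFinite : Uniform par repFinite :=
  have hf : Uniform par fun i a => Nat.find (i.exists_close a) + 1 :=
    (Uniform.of_computable Computable.succ).comp (uniform_close.find exists_close)
  ((uniform_x.beq uniform_y).or ((Uniform.id.beq uniform_x).or (.beq .id uniform_y)).not).cond
    uniform_E <|
    ((uniform_E.comp uniform_x).and (uniform_E.comp uniform_y)).cond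
      (.of_computable (.const true))
      ((uniform_D.comp (uniform_x.pair uniform_y)).and ((uniform_iterate .id hf).beq .id))

end Uniform

end SwapData

/-- The effective form of the closure under multiplication by a transposition.  The cycle decider
is correct as soon as the third program is correct on the two points of the transposition. -/
theorem exists_computable_step : ∃ step : (Code × Code × Code) × ℕ → Code × Code × Code,
    Computable step ∧ ∀ i : SwapData,
      Computes (step i.par).1 i.h ∧ DecidesCycles (step i.par).2.1 i.h ∧
      ((∀ u, i.E u = true ↔ u ∈ CF i.g) → DecidesCF (step i.par).2.2 i.h) := by
  obtain ⟨p, hp, hp'⟩ := SwapData.uniform_h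
  obtain ⟨d, hd, hd'⟩ := SwapData.uniform_repCycles.comp
    ((SwapData.uniform_rep.comp .fst).pair (SwapData.uniform_rep.comp .snd))
  obtain ⟨e, he, he'⟩ := SwapData.uniform_repFinite.comp SwapData.uniform_rep
  refine ⟨fun s => (p s, d s, e s), hp.pair (hd.pair he), fun i => ⟨hp' i, ?_, ?_⟩⟩
  · intro u v
    refine (hd' i (u, v)).trans ?_
    have hu := i.rep_spec u
    have hv := i.rep_spec v
    have : v ∈ cycle i.h u ↔ i.repCycles (i.rep u, i.rep v) = true := by
      rw [i.repCycles_iff hu.2 hv.2]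
      exact ⟨fun h => hu.1.symm.trans (SameCycle.trans h hv.1),
        fun h => hu.1.trans (h.trans hv.1.symm)⟩
    rw [truthValue_eq_encode this]
  · intro hE u
    refine (he' i u).trans ?_
    have hu := i.rep_spec u
    have : u ∈ CF i.h ↔ i.repFinite (i.rep u) = true := by
      rw [i.repFinite_iff hE hu.2]
      exact hu.1.mem_CF_iff
    rw [truthValue_eq_encode this]

/-! ### Multiplication by finitary permutations -/

theorem transposition_pair (x y : ℕ) : transposition (Nat.pair x y) = swap x y := by
  simp [transposition]

theorem swap_mul_mem_Perm {g : Equiv.Perm ℕ} (hg : g ∈ Perm) (x y : ℕ) :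
    swap x y * g ∈ Perm := by
  classical
  obtain ⟨p, d, hp, hd⟩ := mem_Perm_iff.1 hg
  obtain ⟨step, -, hstep⟩ := exists_computable_step
  -- The finiteness of just two cycles is a finite amount of information.
  let E : ℕ → Bool := fun u =>
    bif u == x then decide (x ∈ CF g) else bif u == y then decide (y ∈ CF g) else false
  have hE : Computable E :=
    (Computable.cond (Primrec.beq.to_comp.comp .id (.const x)) (.const _)
      (Computable.cond (Primrec.beq.to_comp.comp .id (.const y)) (.const _) (.const _)))
  obtain ⟨e, he⟩ := exists_code_of_computable hE
  have h := hstep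
    { codes := (p, d, e), t := Nat.pair x y, g := g, E := E, computes := hp, decidesCycles := hd
      eval_E := he
      E_left := by simp [E]
      E_right := by by_cases hxy : y = x <;> simp [E, hxy] }
  rw [← transposition_pair]
  exact mem_Perm_iff.2 ⟨_, _, h.1, h.2.1⟩

/-- The three programs compute `g`, decide its cycles, and decide the finiteness of its cycles. -/
def Describes (s : Code × Code × Code) (g : Equiv.Perm ℕ) : Prop :=
  Computes s.1 g ∧ DecidesCycles s.2.1 g ∧ DecidesCF s.2.2 g

theorem exists_describes_transposition_mul :
    ∃ step : (Code × Code × Code) × ℕ → Code × Code × Code, Computable step ∧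
      ∀ s g t, Describes s g → Describes (step (s, t)) (transposition t * g) := by
  classical
  obtain ⟨step, hc, hstep⟩ := exists_computable_step
  refine ⟨step, hc, fun s g t hs => ?_⟩
  have h := hstep
    { codes := s, t := t, g := g, E := fun u => decide (u ∈ CF g), computes := hs.1
      decidesCycles := hs.2.1
      eval_E := fun u => (hs.2.2 u).trans (congrArg _ (truthValue_eq_encode (by simp)))
      E_left := by simp
      E_right := by simp }
  exact ⟨h.1, h.2.1, h.2.2 fun u => by simp⟩

theorem swap_mul_mem_PermCF {g : Equiv.Perm ℕ} (hg : g ∈ PermCF) (x y : ℕ) :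
    swap x y * g ∈ PermCF := by
  obtain ⟨p, d, e, h⟩ := mem_PermCF_iff.1 hg
  obtain ⟨step, -, hstep⟩ := exists_describes_transposition_mul
  rw [← transposition_pair]
  exact mem_PermCF_iff.2 ⟨_, _, _, hstep (p, d, e) g _ h⟩

/-- Multiplication on the right reduces to multiplication on the left, since
`f * (x y) = (f x f y) * f`. -/
theorem mul_mul_mem_of_swap_mul_mem {S : Set (Equiv.Perm ℕ)}
    (hS : ∀ f ∈ S, ∀ x y : ℕ, swap x y * f ∈ S) {f a b : Equiv.Perm ℕ} (hf : f ∈ S)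
    (ha : a ∈ F) (hb : b ∈ F) : a * f * b ∈ S := by
  have hl : ∀ n t, ∀ f ∈ S, tupleProd n t * f ∈ S := by
    intro n
    induction n with
    | zero => exact fun t f hf => by simpa [tupleProd] using hf
    | succ n ih =>
      intro t f hf
      cases n with
      | zero => exact hS f hf _ _
      | succ n =>
        rw [tupleProd, mul_assoc]
        exact ih _ _ (hS f hf _ _)
  have hr : ∀ n t, ∀ f ∈ S, f * tupleProd n t ∈ S := by
    have hS' : ∀ f ∈ S, ∀ t, f * transposition t ∈ S := fun f hf t => by
      rw [transposition, mul_swap_eq_swap_mul]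
      exact hS f hf _ _
    intro n
    induction n with
    | zero => exact fun t f hf => by simpa [tupleProd] using hf
    | succ n ih =>
      intro t f hf
      cases n with
      | zero => exact hS' f hf _
      | succ n =>
        rw [tupleProd, ← mul_assoc]
        exact hS' _ (ih _ f hf) _
  obtain ⟨z, rfl⟩ := (mem_F_iff_exists_eta a).1 ha
  obtain ⟨w, rfl⟩ := (mem_F_iff_exists_eta b).1 hb
  exact hr _ _ _ (hl _ _ _ hf)

section Fold

variable {S : Type*}

theorem computable_iterate [Primcodable S] {f : S → S} (hf : Computable f) :
    Computable fun p : S × ℕ => f^[p.2] p.1 :=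
  (Computable.nat_rec (f := fun p : S × ℕ => p.2) (g := fun p => p.1) (h := fun _ q => f q.2)
    .snd .fst (hf.comp (Computable.snd.comp .snd))).of_eq fun p => by
      induction p.2 with
      | zero => rfl
      | succ n ih => rw [Function.iterate_succ_apply', ← ih]

/-- Applies the last transposition of a coded tuple and removes it from the tuple. -/
def peel (act : S × ℕ → S) (q : S × ℕ) : S × ℕ := (act (q.1, q.2.unpair.2), q.2.unpair.1)

/-- Applies the transpositions of the product `η z` one after the other, the last one first. -/
def etaFold (act : S × ℕ → S) (q : S × ℕ) : S :=
  Nat.casesOn q.2.unpair.1 q.1 fun n => act ((peel act)^[n] (q.1, q.2.unpair.2))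

theorem computable_etaFold [Primcodable S] {act : S × ℕ → S} (hact : Computable act) :
    Computable (etaFold act) := by
  have hfst : Computable fun q : S × ℕ => q.2.unpair.1 :=
    Computable.fst.comp (Computable.unpair.comp .snd)
  have hsnd : Computable fun q : S × ℕ => q.2.unpair.2 :=
    Computable.snd.comp (Computable.unpair.comp .snd)
  have hpeel : Computable (peel act) := (hact.comp (Computable.fst.pair hsnd)).pair hfst
  have harg : Computable fun p : (S × ℕ) × ℕ => ((p.1.1, p.1.2.unpair.2), p.2) :=
    ((Computable.fst.comp .fst).pair (hsnd.comp .fst)).pair .snd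
  have hiter := (hact.comp (computable_iterate hpeel)).comp harg
  exact Computable.nat_casesOn hfst .fst hiter.to₂

/-- If `act` turns a description of `g` into one of `τ t * g`, then `etaFold act` turns a
description of `g` into one of `η z * g`. -/
theorem etaFold_spec {act : S × ℕ → S} {V : S → Equiv.Perm ℕ → Prop}
    (hV : ∀ s g t, V s g → V (act (s, t)) (transposition t * g)) {s : S} {g : Equiv.Perm ℕ}
    (h : V s g) (z : ℕ) : V (etaFold act (s, z)) (eta z * g) := by
  have key : ∀ n s g t, V s g → V (act ((peel act)^[n] (s, t))) (tupleProd (n + 1) t * g) := by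
    intro n
    induction n with
    | zero => exact fun s g t => hV s g t
    | succ n ih =>
      intro s g t h
      rw [tupleProd, mul_assoc]
      exact ih _ _ _ (hV _ _ _ h)
  rw [etaFold, eta]
  dsimp only
  generalize z.unpair.1 = n
  cases n with
  | zero => rwa [tupleProd, one_mul]
  | succ n => exact key n s g _ h

end Fold

theorem computable_eta_apply : Computable fun p : ℕ × ℕ => eta p.2 p.1 := by
  have hact : Computable fun p : ℕ × ℕ => transposition p.2 p.1 := by
    have h1 : Computable fun p : ℕ × ℕ => p.2.unpair.1 :=
      Computable.fst.comp (Computable.unpair.comp .snd)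
    have h2 : Computable fun p : ℕ × ℕ => p.2.unpair.2 :=
      Computable.snd.comp (Computable.unpair.comp .snd)
    refine (Computable.cond (Primrec.beq.to_comp.comp .fst h1) h2
      (Computable.cond (Primrec.beq.to_comp.comp .fst h2) h1 .fst)).of_eq fun p => ?_
    simp only [transposition, swap_apply_def, Bool.cond_eq_ite, beq_iff_eq]
  refine (computable_etaFold hact).of_eq fun p => ?_
  have := etaFold_spec (act := fun q : ℕ × ℕ => transposition q.2 q.1)
    (V := fun s g => s = g p.1) (fun s g t hs => by rw [hs]; rfl) (g := 1) rfl p.2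
  simpa using this

/-- Deciders for `h` yield deciders for its conjugate by `η w`. -/
theorem exists_deciders_conj : ∃ R : (Code × Code × Code) × ℕ → Code × Code, Computable R ∧
    ∀ s h w, Describes s h → DecidesCycles (R (s, w)).1 ((eta w)⁻¹ * h * eta w) ∧
      DecidesCF (R (s, w)).2 ((eta w)⁻¹ * h * eta w) := by
  classical
  let ι := {i : (Code × Code × Code) × ℕ × Equiv.Perm ℕ // Describes i.1 i.2.2}
  let par : ι → (Code × Code × Code) × ℕ := fun i => (i.1.1, i.1.2.1)
  have heta : Uniform par fun i u => eta i.1.2.1 u :=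
    (Uniform.of_computable computable_eta_apply).comp
      (.pair .id (.param (k := fun s : (Code × Code × Code) × ℕ => s.2) .snd))
  have hD : Uniform par fun i (p : ℕ × ℕ) => decide (i.1.2.2.SameCycle p.1 p.2) :=
    ⟨fun s => s.1.2.1, Computable.fst.comp (Computable.snd.comp .fst), fun i p =>
      (i.2.2.1 p.1 p.2).trans (congrArg _ (truthValue_eq_encode (by simp; rfl)))⟩
  have hE : Uniform par fun i u => decide (u ∈ CF i.1.2.2) :=
    ⟨fun s => s.1.2.2, Computable.snd.comp (Computable.snd.comp .fst), fun i u =>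
      (i.2.2.2 u).trans (congrArg _ (truthValue_eq_encode (by simp)))⟩
  obtain ⟨d, hd, hd'⟩ := hD.comp ((heta.comp .fst).pair (heta.comp .snd))
  obtain ⟨e, he, he'⟩ := hE.comp heta
  have hconj : ∀ (c h : Equiv.Perm ℕ) (u v : ℕ),
      (c⁻¹ * h * c).SameCycle u v ↔ h.SameCycle (c u) (c v) := fun c h u v => by
    simpa using sameCycle_conj (f := h) (g := c⁻¹) (x := u) (y := v)
  refine ⟨fun q => (d q, e q), hd.pair he, fun s h w hs => ⟨fun u v => ?_, fun u => ?_⟩⟩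
  · refine (hd' ⟨(s, w, h), hs⟩ (u, v)).trans (congrArg _ (truthValue_eq_encode ?_).symm)
    rw [decide_eq_true_iff]
    exact hconj _ _ u v
  · refine (he' ⟨(s, w, h), hs⟩ u).trans (congrArg _ (truthValue_eq_encode ?_).symm)
    rw [decide_eq_true_iff, mem_CF_iff, mem_CF_iff]
    simp only [hconj]
    have hpre : {v | h.SameCycle (eta w u) (eta w v)} =
        eta w ⁻¹' {v | h.SameCycle (eta w u) v} := rfl
    rw [hpre]
    exact ⟨fun hf => hf.of_preimage (eta w).surjective,
      fun hf => hf.preimage (eta w).injective.injOn⟩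

theorem exists_deciders_eta_mul_mul_eta :
    ∃ R : (Code × Code × Code) × ℕ × ℕ → Code × Code, Computable R ∧
      ∀ s f z w, Describes s f → DecidesCycles (R (s, z, w)).1 (eta z * f * eta w) ∧
        DecidesCF (R (s, z, w)).2 (eta z * f * eta w) := by
  obtain ⟨step, hc, hstep⟩ := exists_describes_transposition_mul
  have hf := computable_etaFold hc
  obtain ⟨R, hR, hconj⟩ := exists_deciders_conj
  have hz : Computable fun q : (Code × Code × Code) × ℕ × ℕ => q.2.1 := Computable.fst.comp .snd
  have hw : Computable fun q : (Code × Code × Code) × ℕ × ℕ => q.2.2 := Computable.snd.comp .snd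
  refine ⟨fun q => R (etaFold step (etaFold step (q.1, q.2.1), q.2.2), q.2.2),
    hR.comp ((hf.comp ((hf.comp (Computable.fst.pair hz)).pair hw)).pair hw), ?_⟩
  intro s f z w hs
  -- `η z * f * η w` is the conjugate of `η w * η z * f` by `η w`.
  have e : (eta w)⁻¹ * (eta w * (eta z * f)) * eta w = eta z * f * eta w := by group
  rw [← e]
  exact hconj _ _ _ (etaFold_spec hstep (etaFold_spec hstep hs _) _)

/-! ### Uniform cycle deciders and the finiteness of cycles -/

theorem exists_deciders_swap_mul_iff {g : Equiv.Perm ℕ} (hg : g ∈ Perm) :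
    (∃ ρ : ℕ → Code, Computable ρ ∧
      ∀ x y : ℕ, DecidesCycles (ρ (Nat.pair x y)) (swap x y * g)) ↔
    ComputablePred fun x : ℕ => x ∈ CF g := by
  classical
  obtain ⟨p, d, hp, hd⟩ := mem_Perm_iff.1 hg
  constructor
  · rintro ⟨ρ, hρ, h⟩
    by_cases hall : ∀ y, y ∈ CF g
    · exact ⟨fun _ => inferInstance, (Computable.const true).of_eq fun x => by simp [hall]⟩
    -- The cycle of `x` is finite if and only if `(x y)` joins it with a fixed infinite cycle.
    push Not at hall
    obtain ⟨y, hy⟩ := hall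
    have hjoin : Computable fun x => decide ((swap x y * g).SameCycle x y) := by
      have hpart : Partrec fun x => (ρ (Nat.pair x y)).eval (Nat.pair x y) := by
        have hxy : Computable fun x => Nat.pair x y :=
          Primrec₂.natPair.to_comp.comp .id (.const y)
        exact Code.eval_part.comp (hρ.comp hxy) hxy
      refine Computable.encode_iff.1 (hpart.of_eq_tot fun x => ?_)
      rw [h x y x y, truthValue_eq_encode (b := decide ((swap x y * g).SameCycle x y))
        (by simp; rfl)]
      exact Part.mem_some _
    have hcyc : Computable fun x => decide (g.SameCycle x y) :=
      (ComputablePred.decide (computablePred_cycle_iff.2 ⟨d, hd⟩)).comp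
        (Computable.id.pair (.const y))
    refine ⟨fun _ => inferInstance,
      (Primrec.and.to_comp.comp (Primrec.not.to_comp.comp hcyc) hjoin).of_eq fun x => ?_⟩
    rw [Bool.eq_iff_iff]
    simp only [Bool.and_eq_true, Bool.not_eq_true', decide_eq_false_iff_not, decide_eq_true_iff]
    by_cases hs : g.SameCycle x y
    · simp [hs, hs.mem_CF_iff, hy]
    · have hne : x ≠ y := fun e => hs (e ▸ SameCycle.refl g x)
      simp [hs, hy, sameCycle_swap_mul_iff hne]
  · intro h
    obtain ⟨e, he⟩ := computablePred_CF_iff.1 h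
    obtain ⟨step, hc, hstep⟩ := exists_describes_transposition_mul
    refine ⟨fun t => (step ((p, d, e), t)).2.1,
      Computable.fst.comp (Computable.snd.comp (hc.comp ((Computable.const _).pair .id))),
      fun x y => ?_⟩
    have := (hstep (p, d, e) g (Nat.pair x y) ⟨hp, hd, he⟩).2.1
    rwa [transposition_pair] at this

/-! ### A permutation with decidable cycles and undecidable finiteness of cycles -/

section Path

variable (E : ℕ → Bool)

/-- The numbers form a path, with an edge between `i` and `i + 1` whenever `E i`.  This function
exchanges the endpoints of every edge whose left endpoint has the parity `r`.  (For `i = 0` the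
truncated difference `i - 1` makes the last line correct.) -/
def edgeFlip (r i : ℕ) : ℕ :=
  if i % 2 = r then (if E i = true then i + 1 else i)
  else (if E (i - 1) = true then i - 1 else i)

variable {E} in
theorem edgeFlip_of_mod_eq {r i : ℕ} (h : i % 2 = r) :
    edgeFlip E r i = if E i = true then i + 1 else i := if_pos h

variable {E} in
theorem edgeFlip_succ_of_mod_ne {r i : ℕ} (h : (i + 1) % 2 ≠ r) :
    edgeFlip E r (i + 1) = if E i = true then i else i + 1 := if_neg h

variable {E} in
theorem edgeFlip_zero_of_ne {r : ℕ} (h : 0 % 2 ≠ r) : edgeFlip E r 0 = 0 := by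
  rw [edgeFlip, if_neg h]
  split_ifs <;> rfl

theorem edgeFlip_involutive {r : ℕ} (hr : r < 2) : Function.Involutive (edgeFlip E r) := by
  intro i
  by_cases h : i % 2 = r
  · have h' : (i + 1) % 2 ≠ r := by omega
    by_cases hE : E i = true <;>
      simp [edgeFlip_of_mod_eq h, edgeFlip_succ_of_mod_ne h', hE]
  · rcases i with _ | i
    · rw [edgeFlip_zero_of_ne h, edgeFlip_zero_of_ne h]
    · have h' : i % 2 = r := by omega
      by_cases hE : E i = true <;>
        simp [edgeFlip_of_mod_eq h', edgeFlip_succ_of_mod_ne h, hE]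

/-- The product of the two involutions that flip the edges of either parity.  Its cycles are the
connected components of the path. -/
def pathPerm : Equiv.Perm ℕ :=
  (edgeFlip_involutive E (r := 0) (by omega)).toPerm *
    (edgeFlip_involutive E (r := 1) (by omega)).toPerm

theorem pathPerm_apply (i : ℕ) : pathPerm E i = edgeFlip E 0 (edgeFlip E 1 i) := rfl

/-- The least element of the connected component of `i` in the path. -/
def lowest : ℕ → ℕ
  | 0 => 0
  | i + 1 => if E i = true then lowest i else i + 1

variable {E}

theorem lowest_edgeFlip (r i : ℕ) : lowest E (edgeFlip E r i) = lowest E i := by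
  by_cases h : i % 2 = r
  · by_cases hE : E i = true <;> simp [edgeFlip_of_mod_eq h, hE, lowest]
  · rcases i with _ | i
    · rw [edgeFlip_zero_of_ne h]
    · by_cases hE : E i = true <;> simp [edgeFlip_succ_of_mod_ne h, hE, lowest]

/-- Neighbours in the path lie in the same cycle: from one of them, the product of the involutions
leads to the other one or to its other neighbour. -/
theorem sameCycle_pathPerm_succ {i : ℕ} (h : E i = true) : (pathPerm E).SameCycle i (i + 1) := by
  induction i with
  | zero =>
    have : pathPerm E 0 = 1 := by simp [pathPerm_apply, edgeFlip, h]
    exact ⟨1, by simpa using this⟩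
  | succ i ih =>
    -- It suffices that `i + 1` or, if there is an edge to the left, `i` is connected to `i + 2`.
    have key : (pathPerm E).SameCycle (if E i = true then i else i + 1) (i + 2) := by
      rcases Nat.mod_two_eq_zero_or_one i with hi | hi
      · have : pathPerm E (i + 2) = if E i = true then i else i + 1 := by
          rw [pathPerm_apply, edgeFlip_succ_of_mod_ne (by omega), if_pos h,
            edgeFlip_succ_of_mod_ne (by omega)]
        rw [← this]
        exact sameCycle_apply_left.2 (SameCycle.refl _ _)
      · have h1 : (i + 1) % 2 = 0 := by omega
        have : pathPerm E (if E i = true then i else i + 1) = i + 2 := by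
          have h2 : edgeFlip E 1 (if E i = true then i else i + 1) = i + 1 := by
            split_ifs with hE
            · rw [edgeFlip_of_mod_eq hi, if_pos hE]
            · rw [edgeFlip_succ_of_mod_ne (by omega), if_neg hE]
          rw [pathPerm_apply, h2, edgeFlip_of_mod_eq h1, if_pos h]
        rw [← this]
        exact sameCycle_apply_right.2 (SameCycle.refl _ _)
    by_cases hE : E i = true
    · rw [if_pos hE] at key
      exact (ih hE).symm.trans key
    · rwa [if_neg hE] at key

theorem sameCycle_pathPerm_iff {i j : ℕ} :
    (pathPerm E).SameCycle i j ↔ lowest E i = lowest E j := by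
  constructor
  · intro h
    refine (h.mem_of_forall (S := {k | lowest E k = lowest E i}) (fun u => ?_) rfl).symm
    simp only [Set.mem_ofPred_eq, pathPerm_apply, lowest_edgeFlip]
  · have key : ∀ i, (pathPerm E).SameCycle i (lowest E i) := by
      intro i
      induction i with
      | zero => exact SameCycle.refl _ _
      | succ i ih =>
        rw [lowest]
        split_ifs with hE
        · exact (sameCycle_pathPerm_succ hE).symm.trans ih
        · exact SameCycle.refl _ _
    intro h
    exact (key i).trans (h ▸ (key j).symm)

theorem zero_mem_CF_pathPerm_iff : 0 ∈ CF (pathPerm E) ↔ ∃ k, E k = false := by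
  simp only [mem_CF_iff, sameCycle_pathPerm_iff]
  constructor
  · intro h
    by_contra! hE
    have hz : ∀ i, lowest E i = lowest E 0 := by
      intro i
      induction i with
      | zero => rfl
      | succ i ih => exact (if_pos (by simpa using hE i)).trans ih
    exact Set.infinite_univ (h.subset fun i _ => (hz i).symm)
  · rintro ⟨k, hk⟩
    have hlow : ∀ n, k < lowest E (k + 1 + n) := by
      intro n
      induction n with
      | zero => simp [lowest, hk]
      | succ n ih =>
        rw [← add_assoc, lowest]
        split_ifs
        · exact ih
        · omega
    refine (Set.finite_Iic k).subset fun j hj => ?_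
    by_contra hlt
    obtain ⟨n, rfl⟩ := Nat.exists_eq_add_of_lt (not_le.1 hlt)
    have h1 := hlow n
    have h2 : lowest E 0 = lowest E (k + n + 1) := hj
    rw [show k + 1 + n = k + n + 1 by omega, ← h2] at h1
    exact absurd h1 (Nat.not_lt_zero _)

end Path

/-- Acts on the column `{⟨e, i⟩ | i ∈ ℕ}` as the permutation `pathPerm (E e)` acts on
the numbers. -/
def columnPerm (E : ℕ → ℕ → Bool) : Equiv.Perm ℕ :=
  Nat.pairEquiv.permCongr (Equiv.prodCongrRight fun e => pathPerm (E e))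

section Column

variable {E : ℕ → ℕ → Bool}

theorem columnPerm_apply (m : ℕ) :
    columnPerm E m = Nat.pair m.unpair.1 (pathPerm (E m.unpair.1) m.unpair.2) := rfl

theorem columnPerm_iterate (n m : ℕ) :
    (columnPerm E)^[n] m = Nat.pair m.unpair.1 ((pathPerm (E m.unpair.1))^[n] m.unpair.2) := by
  induction n with
  | zero => simp
  | succ n ih => simp [Function.iterate_succ_apply', ih, columnPerm_apply]

theorem sameCycle_columnPerm_iff {m n : ℕ} : (columnPerm E).SameCycle m n ↔
    m.unpair.1 = n.unpair.1 ∧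
      lowest (E m.unpair.1) m.unpair.2 = lowest (E n.unpair.1) n.unpair.2 := by
  have key : ∀ m n k : ℕ, (columnPerm E)^[k] m = n ↔
      m.unpair.1 = n.unpair.1 ∧ (pathPerm (E m.unpair.1))^[k] m.unpair.2 = n.unpair.2 := by
    intro m n k
    rw [columnPerm_iterate]
    constructor
    · rintro rfl
      simp
    · rintro ⟨h1, h2⟩
      rw [h2, h1, Nat.pair_unpair]
  simp only [sameCycle_iff_exists_iterate, key]
  constructor
  · rintro ⟨k, ⟨h1, h2⟩ | ⟨h1, h2⟩⟩
    · refine ⟨h1, ?_⟩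
      rw [← h1]
      exact sameCycle_pathPerm_iff.1 (sameCycle_iff_exists_iterate.2 ⟨k, .inl h2⟩)
    · refine ⟨h1.symm, ?_⟩
      rw [← h1]
      exact sameCycle_pathPerm_iff.1 (sameCycle_iff_exists_iterate.2 ⟨k, .inr h2⟩)
  · rintro ⟨h1, h2⟩
    rw [← h1] at h2 ⊢
    obtain ⟨k, h | h⟩ := sameCycle_iff_exists_iterate.1 (sameCycle_pathPerm_iff.2 h2)
    · exact ⟨k, .inl ⟨rfl, h⟩⟩
    · exact ⟨k, .inr ⟨rfl, h⟩⟩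

theorem pair_zero_mem_CF_columnPerm_iff {e : ℕ} :
    Nat.pair e 0 ∈ CF (columnPerm E) ↔ ∃ k, E e k = false := by
  rw [← zero_mem_CF_pathPerm_iff, mem_CF_iff, mem_CF_iff]
  have : {n | (columnPerm E).SameCycle (Nat.pair e 0) n} =
      Nat.pair e '' {i | (pathPerm (E e)).SameCycle 0 i} := by
    ext n
    simp only [Set.mem_ofPred_eq, Set.mem_image, sameCycle_columnPerm_iff,
      sameCycle_pathPerm_iff, Nat.unpair_pair]
    constructor
    · rintro ⟨rfl, h⟩
      exact ⟨n.unpair.2, h, Nat.pair_unpair n⟩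
    · rintro ⟨i, h, rfl⟩
      simpa using h
  rw [this, Set.finite_image_iff]
  intro i _ j _ h
  exact (Nat.pair_eq_pair.1 h).2

theorem columnPerm_mem_Perm (hE : Primrec₂ E) : columnPerm E ∈ Perm := by
  have hedge : ∀ {e i : ℕ × ℕ → ℕ}, Primrec e → Primrec i →
      PrimrecPred fun p => E (e p) (i p) = true := fun he hi =>
    Primrec.eq.comp (hE.comp he hi) (Primrec.const true)
  have hflip : ∀ r, Primrec₂ fun e i => edgeFlip (E e) r i := fun r =>
    Primrec.ite (Primrec.eq.comp (Primrec.nat_mod.comp .snd (.const 2)) (.const r))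
      (Primrec.ite (hedge .fst .snd) (Primrec.succ.comp .snd) .snd)
      (Primrec.ite (hedge .fst (Primrec.pred.comp .snd)) (Primrec.pred.comp .snd) .snd)
  have hfst : Primrec fun m : ℕ => m.unpair.1 := Primrec.fst.comp .unpair
  have hsnd : Primrec fun m : ℕ => m.unpair.2 := Primrec.snd.comp .unpair
  have hlow : Primrec₂ fun e i => lowest (E e) i := by
    refine (Primrec.nat_rec (α := ℕ) (f := fun _ => 0)
      (g := fun e q => if E e q.1 = true then q.2 else q.1 + 1) (.const 0) ?_).of_eq fun e i => ?_
    · have h1 : Primrec fun p : ℕ × ℕ × ℕ => p.2.1 := Primrec.fst.comp .snd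
      exact Primrec.ite (Primrec.eq.comp (hE.comp .fst h1) (.const true))
        (Primrec.snd.comp .snd) (Primrec.succ.comp h1)
    · induction i with
      | zero => rfl
      | succ i ih => simp only [lowest, ← ih]
  have hG : columnPerm E ∈ G :=
    (Primrec₂.natPair.comp hfst ((hflip 0).comp hfst ((hflip 1).comp hfst hsnd))).to_comp
  refine mem_Perm_iff.2 ?_
  obtain ⟨p, hp⟩ := mem_G_iff.1 hG
  have hrel : PrimrecPred fun q : ℕ × ℕ => q.1.unpair.1 = q.2.unpair.1 ∧
      lowest (E q.1.unpair.1) q.1.unpair.2 = lowest (E q.2.unpair.1) q.2.unpair.2 :=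
    (Primrec.eq.comp (hfst.comp .fst) (hfst.comp .snd)).and
      (Primrec.eq.comp (hlow.comp (hfst.comp .fst) (hsnd.comp .fst))
        (hlow.comp (hfst.comp .snd) (hsnd.comp .snd)))
  obtain ⟨d, hd⟩ := computablePred_cycle_iff.1
    (hrel.computablePred.of_eq fun q => sameCycle_columnPerm_iff.symm)
  exact ⟨p, d, hp, hd⟩

end Column

/-- In the column of a program, the edges of the path are present until the program halts. -/
theorem exists_mem_Perm_not_computablePred_CF :
    ∃ g ∈ Perm, ¬ ComputablePred fun x : ℕ => x ∈ CF g := by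
  let E : ℕ → ℕ → Bool := fun e i => !(Code.evaln i (Denumerable.ofNat Code e) 0).isSome
  have hE : Primrec₂ E :=
    Primrec.not.comp (Primrec.option_isSome.comp (Code.primrec_evaln.comp
      ((Primrec.snd.pair ((Primrec.ofNat Code).comp .fst)).pair (.const 0))))
  refine ⟨columnPerm E, columnPerm_mem_Perm hE, fun h => ComputablePred.halting_problem 0 ?_⟩
  have hc : Computable fun c : Code => Nat.pair (encode c) 0 :=
    Primrec₂.natPair.to_comp.comp Computable.encode (.const 0)
  refine (ComputablePred.computable_of_manyOneReducible ⟨_, hc, fun _ => Iff.rfl⟩ h).of_eq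
    fun c => ?_
  rw [pair_zero_mem_CF_columnPerm_iff, Part.dom_iff_mem]
  simp only [E, Denumerable.ofNat_encode, Bool.not_eq_false', Option.isSome_iff_exists,
    Code.evaln_complete]
  exact exists_comm

end RecursivePermutations

theorem mainTheorem11 :
    -- `Perm` is closed under multiplication with finitary permutations
    (∀ f ∈ RecursivePermutations.Perm,
      ∀ a ∈ RecursivePermutations.F, ∀ b ∈ RecursivePermutations.F,
        a * f * b ∈ RecursivePermutations.Perm) ∧
    -- so is `PermCF`
    (∀ f ∈ RecursivePermutations.PermCF,
      ∀ a ∈ RecursivePermutations.F, ∀ b ∈ RecursivePermutations.F,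
        a * f * b ∈ RecursivePermutations.PermCF) ∧
    -- constructively: one algorithm finds both deciders for `a * f * b` from a program for `f`,
    -- the two deciders for `f`, and `eta` indices of `a` and `b`
    (∃ R : (Nat.Partrec.Code × Nat.Partrec.Code × Nat.Partrec.Code) × ℕ × ℕ →
        Nat.Partrec.Code × Nat.Partrec.Code,
      Computable R ∧
      ∀ f ∈ RecursivePermutations.PermCF, ∀ p d e : Nat.Partrec.Code,
        RecursivePermutations.Computes p f →
        RecursivePermutations.DecidesCycles d f →
        RecursivePermutations.DecidesCF e f →
        ∀ z w : ℕ,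
          RecursivePermutations.DecidesCycles (R ((p, d, e), z, w)).1
            (RecursivePermutations.eta z * f * RecursivePermutations.eta w) ∧
          RecursivePermutations.DecidesCF (R ((p, d, e), z, w)).2
            (RecursivePermutations.eta z * f * RecursivePermutations.eta w)) ∧
    -- some `g` in `Perm` has no recursive map from pairs to cycle deciders of `(x y) g`
    (∃ g ∈ RecursivePermutations.Perm,
      ¬ ∃ ρ : ℕ → Nat.Partrec.Code, Computable ρ ∧
        ∀ x y : ℕ, RecursivePermutations.DecidesCycles (ρ (Nat.pair x y)) (Equiv.swap x y * g)) ∧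
    -- for `g` in `Perm`, this failure happens exactly when `CF g` is undecidable
    (∀ g ∈ RecursivePermutations.Perm,
      (¬ ∃ ρ : ℕ → Nat.Partrec.Code, Computable ρ ∧
        ∀ x y : ℕ, RecursivePermutations.DecidesCycles (ρ (Nat.pair x y)) (Equiv.swap x y * g)) ↔
      ¬ ComputablePred fun x : ℕ => x ∈ RecursivePermutations.CF g) := by
  open RecursivePermutations in
  refine ⟨fun f hf a ha b hb => mul_mul_mem_of_swap_mul_mem
      (fun _ hg => swap_mul_mem_Perm hg) hf ha hb,
    fun f hf a ha b hb => mul_mul_mem_of_swap_mul_mem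
      (fun _ hg => swap_mul_mem_PermCF hg) hf ha hb, ?_, ?_,
    fun g hg => not_congr (exists_deciders_swap_mul_iff hg)⟩
  · obtain ⟨R, hR, h⟩ := RecursivePermutations.exists_deciders_eta_mul_mul_eta
    exact ⟨R, hR, fun f _ p d e hp hd he z w => h (p, d, e) f z w ⟨hp, hd, he⟩⟩
  · obtain ⟨g, hg, h⟩ := RecursivePermutations.exists_mem_Perm_not_computablePred_CF
    exact ⟨g, hg, fun hρ => h ((RecursivePermutations.exists_deciders_swap_mul_iff hg).1 hρ)⟩
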